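/- There exist a compact Hausdorff space $L'$ and a compact subspace $L\subseteq L'$ such that: 1. $L$ is a dyadic compactum, i.e. a continuous image of a Cantor cube $\{0,1\}^{\kappa}$ for some cardinal $\kappa$; 2. the weight of $L$ (the least cardinality of a base of its topology) is exactly $\mathfrak c=2^{\aleph_0}$; 3. $L'$ is a countable discrete extension of $L$, i.e. $L'\setminus L$ is countable and, in the subspace topology, discrete; 4. there is no extension operator $E\colon C(L)\to C(L')$, i.e. no bounded linear operator $E$ between these Banach spaces of continuous real-valued functions (with the supremum norms) such that $(Eg)|_L=g$ for every $g\in C(L)$. -/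

import Mathlib

open scoped Cardinal

universe u

/-- The weight of a topological space: the least cardinality of a base of its topology. -/
noncomputable def topologicalWeight (X : Type u) [TopologicalSpace X] : Cardinal.{u} :=
  sInf {κ : Cardinal.{u} | ∃ B : Set (Set X), TopologicalSpace.IsTopologicalBasis B ∧ #B = κ}

/-- A dyadic compactum: a compact Hausdorff space that is a continuous image of some Cantor cube
`2 ^ ι` (the product of copies of the two-point discrete space, indexed by a set `ι`). -/
def IsDyadicCompactum (X : Type u) [TopologicalSpace X] : Prop :=
  CompactSpace X ∧ T2Space X ∧
    ∃ (ι : Type u) (f : (ι → Bool) → X), Continuous f ∧ Function.Surjective f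

/-- `X` is a countable discrete extension of its subspace `L`: both are compact Hausdorff spaces
and the complement `X \ L` is countable and, in the subspace topology, discrete. -/
structure IsCountableDiscreteExtension {X : Type u} [TopologicalSpace X] (L : Set X) : Prop where
  compactSpace : CompactSpace X
  t2Space : T2Space X
  isCompact : IsCompact L
  countable_compl : Lᶜ.Countable
  discrete_compl : DiscreteTopology (Lᶜ : Set X)

/-- `E : C(L) → C(X)` is an extension operator: a bounded linear operator (that is, a continuous
linear map) with `(E g)|L = g` for every `g`. On compact spaces the topology that Mathlib
puts on `C(_, ℝ)` is the one of the supremum norm. -/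
def IsExtensionOperator {X : Type u} [TopologicalSpace X] {L : Set X}
    (E : C(L, ℝ) →L[ℝ] C(X, ℝ)) : Prop :=
  ∀ g : C(L, ℝ), (E g).restrict L = g

open Filter

/-! ### The extension built from a coloured almost disjoint family. -/

section Construction

variable {I D : Type} (A : I → Set D) (col : I → ℕ)

/-! Take `I` to be the branches of the tree of finite sequences of naturals, `D` the tree itself,
and `A x` the set of nodes on `x`. An extension operator must extend the coordinate function of each
branch; linearity and boundedness, tested on functions supported over distinct colours, then yield
sets `T k` that almost contain every branch of colour `k`, while no node lies in all of `T 0, …, T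
(m - 1)` for a suitable `m` (`exists_almost_cover_of_extensionOperator`).

The colour of a branch is its limit along a nonprincipal ultrafilter. For this colouring each `T k`
must contain a full cone inside any given cone (`exists_cylinder_subset`), so nested cones give a
node in any finite number of the `T k`: a contradiction. -/

/-- The closed subset of `2 ^ I × 2 ^ D` consisting of the points `(z, 0)`, where the support of `z`
lies in one colour class, and of the points `(fun x => 1_{A x} s, e_s)` for `s : D`. -/
def extensionSet : Set ((I → Bool) × (D → Bool)) :=
  {p | (∀ s, p.2 s = true → (∀ x, p.1 x = true ↔ s ∈ A x) ∧ ∀ t, p.2 t = true → t = s) ∧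
    ∀ x y, col x ≠ col y → p.1 x = true → p.1 y = true → ∃ s ∈ A x ∩ A y, p.2 s = true}

/-- The part of `extensionSet A col` whose second coordinate vanishes. -/
def coreSet : Set (extensionSet A col) := {p | ∀ s, p.1.2 s = false}

variable {A col}

/-- Finiteness of `A x ∩ A y` turns the existential condition into a finite union of clopen sets. -/
theorem isClosed_extensionSet (hA : ∀ x y, col x ≠ col y → (A x ∩ A y).Finite) :
    IsClosed (extensionSet A col) := by
  have h1 : ∀ x : I, IsClopen {p : (I → Bool) × (D → Bool) | p.1 x = true} := fun x =>
    (isClopen_discrete {true}).preimage (f := fun p : (I → Bool) × (D → Bool) => p.1 x)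
      (by fun_prop)
  have h2 : ∀ s : D, IsClopen {p : (I → Bool) × (D → Bool) | p.2 s = true} := fun s =>
    (isClopen_discrete {true}).preimage (f := fun p : (I → Bool) × (D → Bool) => p.2 s)
      (by fun_prop)
  have h3 : ∀ (s : D) (x : I),
      IsClosed {p : (I → Bool) × (D → Bool) | p.1 x = true ↔ s ∈ A x} := by
    intro s x
    by_cases h : s ∈ A x
    · simpa [h] using (h1 x).1
    · simpa [h, Set.compl_ofPred] using (h1 x).compl.1
  unfold extensionSet
  simp only [Set.ofPred_and, Set.ofPred_forall]
  refine IsClosed.inter (isClosed_iInter fun s => ?_)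
    (isClosed_iInter fun x => isClosed_iInter fun y => isClosed_iInter fun hxy => ?_)
  · refine isClosed_imp (h2 s).2 ?_
    simp only [Set.ofPred_and, Set.ofPred_forall]
    exact (isClosed_iInter (h3 s)).inter
      (isClosed_iInter fun t => isClosed_imp (h2 t).2 isClosed_const)
  · refine isClosed_imp (h1 x).2 (isClosed_imp (h1 y).2 ?_)
    have : {p : (I → Bool) × (D → Bool) | ∃ s ∈ A x ∩ A y, p.2 s = true} =
        ⋃ s ∈ A x ∩ A y, {p | p.2 s = true} := by
      ext p; simp
    rw [this]
    exact (hA x y hxy).isClosed_biUnion fun s _ => (h2 s).1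

theorem isClosed_coreSet : IsClosed (coreSet A col) := by
  unfold coreSet
  simp only [Set.ofPred_forall]
  exact isClosed_iInter fun s => isClosed_eq (by fun_prop) continuous_const

open Classical in
/-- The isolated point of `extensionSet A col` attached to `s : D`. -/
noncomputable def isolatedPoint (A : I → Set D) (col : I → ℕ) (s : D) : extensionSet A col :=
  ⟨(fun x => decide (s ∈ A x), fun t => decide (t = s)), by
    refine ⟨fun t ht => ?_, fun x y _ hx hy => ⟨s, ?_⟩⟩
    · obtain rfl : t = s := by simpa using ht
      simp
    · simpa using ⟨by simpa using hx, by simpa using hy⟩⟩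

theorem isolatedPoint_fst {s : D} {x : I} :
    (isolatedPoint A col s).1.1 x = true ↔ s ∈ A x := by
  simp [isolatedPoint]

theorem isolatedPoint_snd {s t : D} : (isolatedPoint A col s).1.2 t = true ↔ t = s := by
  simp [isolatedPoint]

theorem isolatedPoint_injective : Function.Injective (isolatedPoint A col) := fun s t h => by
  have := (isolatedPoint_snd (A := A) (col := col) (s := s) (t := s)).2 rfl
  rw [h] at this
  exact isolatedPoint_snd.1 this

theorem isolatedPoint_notMem (s : D) : isolatedPoint A col s ∉ coreSet A col := fun h => by
  simpa [isolatedPoint_snd.2 rfl] using h s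

theorem eq_isolatedPoint {p : extensionSet A col} {s : D} (h : p.1.2 s = true) :
    p = isolatedPoint A col s := by
  obtain ⟨hx, ht⟩ := p.2.1 s h
  refine Subtype.ext (Prod.ext (funext fun x => ?_) (funext fun t => ?_))
  · rw [Bool.eq_iff_iff, hx, isolatedPoint_fst]
  · rw [Bool.eq_iff_iff, isolatedPoint_snd]
    exact ⟨ht t, fun e => e ▸ h⟩

theorem exists_of_notMem_coreSet {p : extensionSet A col} (h : p ∉ coreSet A col) :
    ∃ s, p = isolatedPoint A col s := by
  simp only [coreSet, Set.mem_ofPred_eq, not_forall, Bool.not_eq_false] at h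
  exact h.imp fun s hs => eq_isolatedPoint hs

theorem isOpen_singleton_isolatedPoint (s : D) :
    IsOpen ({isolatedPoint A col s} : Set (extensionSet A col)) := by
  have : ({isolatedPoint A col s} : Set (extensionSet A col)) =
      (fun p => p.1.2 s) ⁻¹' {true} := by
    ext p
    refine ⟨?_, fun h => eq_isolatedPoint h⟩
    rintro rfl
    exact isolatedPoint_snd.2 rfl
  rw [this]
  exact (isOpen_discrete _).preimage (by fun_prop)

theorem isCountableDiscreteExtension_coreSet [Countable D]
    (hA : ∀ x y, col x ≠ col y → (A x ∩ A y).Finite) :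
    IsCountableDiscreteExtension (coreSet A col) := by
  have : CompactSpace (extensionSet A col) :=
    isCompact_iff_compactSpace.1 (isClosed_extensionSet hA).isCompact
  refine ⟨this, inferInstance, isClosed_coreSet.isCompact, ?_, ?_⟩
  · refine (Set.countable_range (isolatedPoint A col)).mono fun p hp => ?_
    obtain ⟨s, rfl⟩ := exists_of_notMem_coreSet hp
    exact ⟨s, rfl⟩
  · refine discreteTopology_iff_isOpen_singleton.2 fun ⟨p, hp⟩ => ?_
    obtain ⟨s, rfl⟩ := exists_of_notMem_coreSet hp
    convert (isOpen_singleton_isolatedPoint (A := A) (col := col) s).preimage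
      continuous_subtype_val using 1
    ext q
    simp [Subtype.ext_iff]

/-- A point of `coreSet A col` given by a set of coordinates within one colour class. -/
def corePoint (A : I → Set D) (z : I → Bool)
    (hz : ∀ x y, z x = true → z y = true → col x = col y) : coreSet A col :=
  ⟨⟨(z, fun _ => false), by simp, fun x y hxy hx hy => (hxy (hz x y hx hy)).elim⟩, fun _ => rfl⟩

theorem col_eq_of_mem_coreSet (p : coreSet A col) {x y : I} (hx : p.1.1.1 x = true)
    (hy : p.1.1.1 y = true) : col x = col y := by
  by_contra h
  obtain ⟨s, -, hs⟩ := p.1.2.2 x y h hx hy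
  simp [p.2 s] at hs

theorem corePoint_fst (p : coreSet A col) :
    corePoint A p.1.1.1 (fun _ _ => col_eq_of_mem_coreSet p) = p := by
  refine Subtype.ext (Subtype.ext (Prod.ext rfl (funext fun s => ?_)))
  exact (p.2 s).symm

/-- The coordinates in `ℕ` select a colour, the first one marked `true`, and the coordinates in `I`
outside that colour are erased. If no colour is marked, everything is erased. -/
theorem isDyadicCompactum_coreSet (hA : ∀ x y, col x ≠ col y → (A x ∩ A y).Finite) :
    IsDyadicCompactum (coreSet A col) := by
  have : CompactSpace (extensionSet A col) :=
    isCompact_iff_compactSpace.1 (isClosed_extensionSet hA).isCompact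
  refine ⟨isCompact_iff_compactSpace.1 isClosed_coreSet.isCompact, inferInstance, ℕ ⊕ I, ?_⟩
  let first : (ℕ ⊕ I → Bool) → ℕ → Bool := fun w j =>
    w (.inl j) && (List.range j).all fun i => !w (.inl i)
  have first_eq : ∀ w i j, first w i = true → first w j = true → i = j := by
    intro w i j hi hj
    simp only [first, Bool.and_eq_true, List.all_eq_true, List.mem_range, Bool.not_eq_true'] at hi hj
    rcases lt_trichotomy i j with h | h | h
    · simp [hj.2 i h] at hi
    · exact h
    · simp [hi.2 j h] at hj
  have first_cont : ∀ j, Continuous fun w => first w j := by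
    intro j
    have hall : ∀ l : List ℕ, Continuous fun w : ℕ ⊕ I → Bool => l.all fun i => !w (.inl i) := by
      intro l
      induction l with
      | nil => exact continuous_const
      | cons a l ih =>
        exact (continuous_of_discreteTopology (f := fun b : Bool × Bool => !b.1 && b.2)).comp
          ((continuous_apply (Sum.inl a)).prodMk ih)
    exact (continuous_of_discreteTopology (f := fun b : Bool × Bool => b.1 && b.2)).comp
      ((continuous_apply (Sum.inl j)).prodMk (hall _))
  refine ⟨fun w => corePoint A (fun x => w (.inr x) && first w (col x)) fun x y hx hy =>
    first_eq w _ _ (Bool.and_eq_true_iff.1 hx).2 (Bool.and_eq_true_iff.1 hy).2, ?_, fun p => ?_⟩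
  · refine Continuous.subtype_mk (Continuous.subtype_mk (.prodMk ?_ continuous_const) _) _
    exact continuous_pi fun x =>
      (continuous_of_discreteTopology (f := fun b : Bool × Bool => b.1 && b.2)).comp
        ((continuous_apply (Sum.inr x)).prodMk (first_cont _))
  · classical
    refine ⟨Sum.elim (fun j => decide (∃ x, p.1.1.1 x = true ∧ col x = j)) p.1.1.1, ?_⟩
    rw [← corePoint_fst p]
    refine Subtype.ext (Subtype.ext (Prod.ext (funext fun x => ?_) rfl))
    change (p.1.1.1 x && _) = p.1.1.1 x
    cases hx : p.1.1.1 x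
    · rfl
    · simp only [first, Sum.elim_inl, Bool.true_and, Bool.and_eq_true, List.all_eq_true,
        List.mem_range, Bool.not_eq_true', decide_eq_true_eq, decide_eq_false_iff_not]
      refine ⟨⟨x, hx, rfl⟩, ?_⟩
      rintro i hi ⟨y, hy, rfl⟩
      exact hi.ne (col_eq_of_mem_coreSet p hy hx)

/-- The first coordinate embeds the core in `2 ^ I`, which bounds the weight above. Below, basic
neighbourhoods of the singleton indicators, each inside `{p | p x = true}`, are pairwise distinct.
-/
theorem topologicalWeight_coreSet [Infinite I] :
    topologicalWeight (coreSet A col) = #I := by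
  classical
  refine le_antisymm ?_ (le_csInf ⟨_, _, TopologicalSpace.isTopologicalBasis_opens, rfl⟩ ?_)
  · let B : Finset I × Finset I → Set (coreSet A col) := fun F =>
      {p | (∀ x ∈ F.1, p.1.1.1 x = true) ∧ ∀ x ∈ F.2, p.1.1.1 x = false}
    have hB : TopologicalSpace.IsTopologicalBasis (Set.range B) := by
      refine TopologicalSpace.isTopologicalBasis_of_isOpen_of_nhds ?_ fun p U hp hU => ?_
      · rintro _ ⟨F, rfl⟩
        have h : ∀ (G : Finset I) (b : Bool),
            IsOpen {p : coreSet A col | ∀ x ∈ G, p.1.1.1 x = b} := by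
          intro G b
          have : {p : coreSet A col | ∀ x ∈ G, p.1.1.1 x = b} =
              ⋂ x ∈ G, (fun p : coreSet A col => p.1.1.1 x) ⁻¹' {b} := by
            ext p; simp
          rw [this]
          exact isOpen_biInter_finset fun x _ => (isOpen_discrete _).preimage (by fun_prop)
        exact (h _ _).inter (h _ _)
      · have hind : Topology.IsInducing fun p : coreSet A col => p.1.1.1 := by
          refine ⟨le_antisymm (Continuous.le_induced (by fun_prop)) ?_⟩
          let f : {z : I → Bool // ∀ x y, z x = true → z y = true → col x = col y} →
              coreSet A col := fun z => corePoint A z.1 z.2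
          have hf : Continuous f :=
            Continuous.subtype_mk (Continuous.subtype_mk
              (continuous_subtype_val.prodMk continuous_const) _) _
          let g : coreSet A col → {z : I → Bool // ∀ x y, z x = true → z y = true → col x = col y} :=
            fun p => ⟨p.1.1.1, fun _ _ => col_eq_of_mem_coreSet p⟩
          have hfg : f ∘ g = id := funext fun p => corePoint_fst p
          have hg : @Continuous _ _
              (TopologicalSpace.induced (fun p : coreSet A col => p.1.1.1) inferInstance) _ g := by
            let _ := TopologicalSpace.induced (fun p : coreSet A col => p.1.1.1) inferInstance
            exact Continuous.subtype_mk continuous_induced_dom _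
          refine continuous_id_iff_le.1 ?_
          rw [← hfg]
          exact @Continuous.comp _ _ _ (_) _ _ _ _ hf hg
        obtain ⟨V, hV, rfl⟩ := hind.isOpen_iff.1 hU
        obtain ⟨F, u, hu, hFV⟩ := isOpen_pi_iff.1 hV _ hp
        have hpB : p ∈ B (F.filter fun x => p.1.1.1 x = true, F.filter fun x => p.1.1.1 x = false) :=
          ⟨fun x hx => (Finset.mem_filter.1 hx).2, fun x hx => (Finset.mem_filter.1 hx).2⟩
        refine ⟨_, Set.mem_range_self _, hpB, fun q hq => hFV fun x hx => ?_⟩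
        have : q.1.1.1 x = p.1.1.1 x := by
          cases h : p.1.1.1 x
          · exact hq.2 x (Finset.mem_filter.2 ⟨hx, h⟩)
          · exact hq.1 x (Finset.mem_filter.2 ⟨hx, h⟩)
        change q.1.1.1 x ∈ u x
        rw [this]
        exact (hu x hx).2
    have hle : topologicalWeight (coreSet A col) ≤ #(Set.range B) := csInf_le' ⟨_, hB, rfl⟩
    refine hle.trans (Cardinal.mk_range_le.trans ?_)
    rw [Cardinal.mk_prod, Cardinal.lift_id, Cardinal.mk_finset_of_infinite,
      Cardinal.mul_eq_self (Cardinal.aleph0_le_mk I)]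
  · rintro _ ⟨B, hB, rfl⟩
    let e : I → coreSet A col := fun x => corePoint A (fun y => decide (y = x)) fun y z hy hz => by
      rw [of_decide_eq_true hy, of_decide_eq_true hz]
    have he : ∀ x, ∃ b ∈ B, e x ∈ b ∧ b ⊆ {p : coreSet A col | p.1.1.1 x = true} := fun x =>
      hB.exists_subset_of_mem_open (by simp [e, corePoint])
        ((isOpen_discrete {true}).preimage (f := fun p : coreSet A col => p.1.1.1 x) (by fun_prop))
    choose b hbB heb hb using he
    refine Cardinal.mk_le_of_injective (f := fun x => (⟨b x, hbB x⟩ : B)) fun x y hxy => ?_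
    have h : e x ∈ b y := by
      have hb' : b x = b y := congrArg Subtype.val hxy
      exact hb' ▸ heb x
    exact (of_decide_eq_true (hb y h)).symm

/-- The compact set `{ε ≤ |f|}` misses the core, so open singletons cover it. -/
theorem finite_isolatedPoint_of_continuous [CompactSpace (extensionSet A col)]
    {f : C(extensionSet A col, ℝ)} (hf : ∀ p ∈ coreSet A col, f p = 0) {ε : ℝ} (hε : 0 < ε) :
    {s | ε ≤ |f (isolatedPoint A col s)|}.Finite := by
  have hK : IsCompact {p | ε ≤ |f p|} :=
    (isClosed_le continuous_const (by fun_prop)).isCompact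
  obtain ⟨t, ht⟩ := hK.elim_finite_subcover (fun s => {isolatedPoint A col s})
    isOpen_singleton_isolatedPoint fun p hp => by
      have hpc : p ∉ coreSet A col := fun h => by
        simp only [Set.mem_ofPred_eq, hf p h, abs_zero] at hp
        exact hε.not_ge hp
      obtain ⟨s, rfl⟩ := exists_of_notMem_coreSet hpc
      exact Set.mem_iUnion.2 ⟨s, rfl⟩
  refine t.finite_toSet.subset fun s hs => ?_
  obtain ⟨r, hr, h⟩ := Set.mem_iUnion₂.1 (ht hs)
  rwa [isolatedPoint_injective (Set.mem_singleton_iff.1 h)]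

/-- If there is an extension operator, then `D` carries sets `T k` that almost contain the sets
`A x` of colour `k` and such that no point belongs to arbitrarily many of them. -/
theorem exists_almost_cover_of_extensionOperator
    (hA : ∀ x y, col x ≠ col y → (A x ∩ A y).Finite)
    {E : C(coreSet A col, ℝ) →L[ℝ] C(extensionSet A col, ℝ)} (hE : IsExtensionOperator E) :
    ∃ T : ℕ → Set D, (∀ x, (A x \ T (col x)).Finite) ∧ ∃ m : ℕ, ∀ s, ∃ k < m, s ∉ T k := by
  have : CompactSpace (extensionSet A col) :=
    isCompact_iff_compactSpace.1 (isClosed_extensionSet hA).isCompact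
  have : CompactSpace (coreSet A col) :=
    isCompact_iff_compactSpace.1 isClosed_coreSet.isCompact
  -- `T k` collects the nodes where some function of norm at most 1, supported over colour `k`, has
  -- an extension exceeding `1 / 2`.
  refine ⟨fun k => {s | ∃ g : C(coreSet A col, ℝ), (∀ p, |g p| ≤ 1) ∧
    (∀ p, g p ≠ 0 → ∃ x, p.1.1.1 x = true ∧ col x = k) ∧ 1 / 2 < E g (isolatedPoint A col s)},
    fun x => ?_, ?_⟩
  · let ind : Bool → ℝ := fun b => if b then 1 else 0
    let h : C(extensionSet A col, ℝ) := ⟨fun p => ind (p.1.1 x),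
      (continuous_of_discreteTopology (f := ind)).comp (by fun_prop)⟩
    have hfin := finite_isolatedPoint_of_continuous (f := E (h.restrict (coreSet A col)) - h)
      (fun p hp => by
        have := DFunLike.congr_fun (hE (h.restrict (coreSet A col))) ⟨p, hp⟩
        simpa [sub_eq_zero] using this) (half_pos one_pos)
    refine hfin.subset fun s ⟨hs, hsT⟩ => ?_
    by_contra hlt
    have hlt' : |E (h.restrict (coreSet A col)) (isolatedPoint A col s) - 1| < 1 / 2 := by
      have hh : h (isolatedPoint A col s) = 1 := by
        change ind _ = 1
        rw [isolatedPoint_fst.2 hs]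
        rfl
      have h' := lt_of_not_ge fun hle => hlt (Set.mem_ofPred_eq.mpr hle)
      rwa [ContinuousMap.sub_apply, hh] at h'
    refine hsT ⟨h.restrict (coreSet A col), fun p => ?_, fun p hp => ⟨x, ?_, rfl⟩, ?_⟩
    · change |ind _| ≤ 1
      cases p.1.1.1 x <;> simp [ind]
    · by_contra hx
      apply hp
      change ind _ = 0
      rw [Bool.not_eq_true _ |>.mp hx]
      rfl
    · linarith [(abs_lt.1 hlt').1]
  · obtain ⟨m, hm⟩ := exists_nat_gt (2 * ‖E‖)
    refine ⟨m, fun s => ?_⟩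
    by_contra! hs
    choose! g hg1 hgs hgE using hs
    -- Different colours give disjoint supports, so the sum keeps norm at most 1, while its
    -- extension at `s` is at least `m / 2 > ‖E‖`.
    have hnorm : ‖∑ k ∈ Finset.range m, g k‖ ≤ 1 := by
      refine (ContinuousMap.norm_le _ zero_le_one).2 fun p => ?_
      rw [ContinuousMap.sum_apply, Real.norm_eq_abs]
      by_cases hp : ∃ k ∈ Finset.range m, g k p ≠ 0
      · obtain ⟨k, hk, hkp⟩ := hp
        rw [Finset.sum_eq_single_of_mem k hk fun j hj hjk => ?_]
        · exact hg1 k (Finset.mem_range.1 hk) p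
        · by_contra hjp
          obtain ⟨x, hx, hxk⟩ := hgs k (Finset.mem_range.1 hk) p hkp
          obtain ⟨y, hy, hyj⟩ := hgs j (Finset.mem_range.1 hj) p hjp
          exact hjk (by rw [← hxk, ← hyj, col_eq_of_mem_coreSet p hx hy])
      · push Not at hp
        rw [Finset.sum_eq_zero hp]
        simp
    have hle : (m : ℝ) * (1 / 2) ≤ E (∑ k ∈ Finset.range m, g k) (isolatedPoint A col s) := by
      rw [map_sum, ContinuousMap.sum_apply]
      calc (m : ℝ) * (1 / 2) = ∑ _k ∈ Finset.range m, (1 / 2 : ℝ) := by simp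
        _ ≤ _ := Finset.sum_le_sum fun k hk => (hgE k (Finset.mem_range.1 hk)).le
    have h1 := (le_abs_self _).trans ((E (∑ k ∈ Finset.range m, g k)).norm_coe_le_norm
      (isolatedPoint A col s))
    have h2 := E.le_of_opNorm_le_of_le le_rfl hnorm
    linarith

end Construction

/-! ### Branches of the tree and the ultrafilter colouring. -/

section Branches

/-- The initial segment of length `n` of a sequence. -/
def initialSegment (x : ℕ → ℕ) (n : ℕ) : List ℕ := (List.range n).map x

@[simp]
theorem length_initialSegment (x : ℕ → ℕ) (n : ℕ) : (initialSegment x n).length = n := by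
  simp [initialSegment]

theorem initialSegment_injective (x : ℕ → ℕ) : Function.Injective (initialSegment x) :=
  fun m n h => by simpa using congrArg List.length h

theorem finite_range_initialSegment_inter {x y : ℕ → ℕ} (h : x ≠ y) :
    (Set.range (initialSegment x) ∩ Set.range (initialSegment y)).Finite := by
  obtain ⟨N, hN⟩ := Function.ne_iff.1 h
  refine ((Set.finite_Iic N).image (initialSegment x)).subset ?_
  rintro _ ⟨⟨n, rfl⟩, ⟨n', hn⟩⟩
  refine ⟨n, ?_, rfl⟩
  obtain rfl : n' = n := by simpa using congrArg List.length hn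
  by_contra hlt
  simp only [Set.mem_Iic, not_le] at hlt
  have := (List.map_inj_left.1 hn) N (List.mem_range.2 hlt)
  exact hN this.symm

theorem exists_sequence_of_prefixes {u : ℕ → List ℕ} (hu : ∀ j, u j <+: u (j + 1))
    (hlt : ∀ j, (u j).length < (u (j + 1)).length) :
    ∃ x : ℕ → ℕ, ∀ j, initialSegment x (u j).length = u j := by
  have hmono : ∀ i j, i ≤ j → u i <+: u j := fun i j h =>
    Nat.le_induction (List.prefix_refl _) (fun n _ ih => ih.trans (hu n)) j h
  have hlen : ∀ j, j ≤ (u j).length := fun j =>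
    (strictMono_nat_of_lt_succ hlt).le_apply
  refine ⟨fun n => (u (n + 1)).getD n 0, fun j => List.ext_getElem (by simp) fun n h1 h2 => ?_⟩
  have hn : n < (u (n + 1)).length := hlen (n + 1)
  simp only [initialSegment, List.getElem_map, List.getElem_range, List.getD_eq_getElem _ _ hn]
  rcases le_total (n + 1) j with h | h
  · exact (hmono _ _ h).getElem hn
  · exact ((hmono _ _ h).getElem h2).symm

theorem initialSegment_eq_of_prefix {x : ℕ → ℕ} {n : ℕ} {v : List ℕ}
    (h : v <+: initialSegment x n) : initialSegment x v.length = v := by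
  have hn : v.length ≤ n := by simpa using h.length_le
  refine List.ext_getElem (by simp) fun i h1 h2 => ?_
  rw [h.getElem h2]
  simp [initialSegment]

theorem eq_of_initialSegment_eq_append_replicate {x : ℕ → ℕ} {n c k i : ℕ} {w : List ℕ}
    (h : initialSegment x n = w ++ List.replicate c k) (hw : w.length ≤ i) (hi : i < n) :
    x i = k := by
  have h1 : (initialSegment x n)[i]? = some (x i) := by simp [initialSegment, hi]
  have hlen : n = w.length + c := by simpa using congrArg List.length h
  rw [h, List.getElem?_append_right hw, List.getElem?_replicate, if_pos (by omega)] at h1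
  exact (Option.some.inj h1).symm

/-- If `T` almost contains every branch `x` with `x n = k` along the hyperfilter, then every finite
sequence has an extension all of whose extensions are in `T`. -/
theorem exists_cylinder_subset {k : ℕ} {T : Set (List ℕ)}
    (hT : ∀ x : ℕ → ℕ, (∀ᶠ n in (hyperfilter ℕ : Filter ℕ), x n = k) →
      ∀ᶠ n in atTop, initialSegment x n ∈ T) (s : List ℕ) :
    ∃ s', s <+: s' ∧ ∀ t, s' <+: t → t ∈ T := by
  by_contra! hcon
  -- Appending `k` forces `w` to be strictly longer than `v`; `[]` is a dummy value off the cone of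
  -- `s`.
  have hf' : ∀ v, ∃ w, s <+: v → v ++ [k] <+: w ∧ w ∉ T := by
    intro v
    by_cases hv : s <+: v
    · obtain ⟨w, hw⟩ := hcon (v ++ [k]) (hv.trans (List.prefix_append _ _))
      exact ⟨w, fun _ => hw⟩
    · exact ⟨[], fun h => (hv h).elim⟩
  choose f hf using hf'
  -- Two branches grow in turn: while one moves to a node outside `T`, the other is padded with `k`
  -- to the same length.
  let u₁ : List ℕ × List ℕ → List ℕ := fun p => f p.1
  let v₁ : List ℕ × List ℕ → List ℕ := fun p =>
    p.2 ++ List.replicate ((u₁ p).length - p.2.length) k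
  let step : List ℕ × List ℕ → List ℕ × List ℕ := fun p =>
    (u₁ p ++ List.replicate ((f (v₁ p)).length - (u₁ p).length) k, f (v₁ p))
  let P : ℕ → List ℕ × List ℕ := fun j => step^[j] (s, s)
  have hP : ∀ j, P (j + 1) = step (P j) := fun j => Function.iterate_succ_apply' _ _ _
  have hlt : ∀ {v w : List ℕ}, v ++ [k] <+: w → v.length < w.length := fun h => by
    simpa using h.length_le
  have hinv : ∀ j, s <+: (P j).1 ∧ s <+: (P j).2 ∧ (P j).1.length = (P j).2.length := by
    intro j
    induction j with
    | zero => exact ⟨List.prefix_refl s, List.prefix_refl s, rfl⟩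
    | succ j ih =>
      obtain ⟨h1, h2, h3⟩ := ih
      have hu := (hf _ h1).1
      have hv := (hf (v₁ (P j)) (h2.trans (List.prefix_append _ _))).1
      have hlu := hlt hu
      have hlv := hlt hv
      rw [hP]
      refine ⟨(h1.trans ((List.prefix_append _ _).trans hu)).trans (List.prefix_append _ _),
        (h2.trans (List.prefix_append _ _)).trans ((List.prefix_append _ _).trans hv), ?_⟩
      simp only [step, v₁, u₁, List.length_append, List.length_replicate] at hlu hlv ⊢
      omega
  have hu : ∀ j, (P j).1 ++ [k] <+: u₁ (P j) ∧ u₁ (P j) ∉ T := fun j => hf _ (hinv j).1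
  have hv : ∀ j, v₁ (P j) ++ [k] <+: (P (j + 1)).2 ∧ (P (j + 1)).2 ∉ T := fun j => by
    rw [hP]
    exact hf _ ((hinv j).2.1.trans (List.prefix_append _ _))
  have hu' : ∀ j, u₁ (P j) <+: (P (j + 1)).1 := fun j => by
    rw [hP]
    exact List.prefix_append _ _
  have hv' : ∀ j, v₁ (P j) <+: (P (j + 1)).2 := fun j => (List.prefix_append _ _).trans (hv j).1
  have hlu : ∀ j, (P j).1.length < (u₁ (P j)).length := fun j => hlt (hu j).1
  have hlen : ∀ j, (v₁ (P j)).length = (u₁ (P j)).length := fun j => by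
    have h1 := hlu j
    have h2 := (hinv j).2.2
    simp only [v₁, List.length_append, List.length_replicate]
    omega
  have hlv : ∀ j, (u₁ (P j)).length < (P (j + 1)).2.length := fun j => hlen j ▸ hlt (hv j).1
  have hstep : ∀ j, (P j).2.length < (P (j + 1)).2.length := fun j =>
    (hinv j).2.2 ▸ (hlu j).trans (hlv j)
  obtain ⟨x, hx⟩ := exists_sequence_of_prefixes (u := fun j => (P j).1)
    (fun j => ((List.prefix_append _ _).trans (hu j).1).trans (hu' j))
    (fun j => by simpa only [(hinv _).2.2] using hstep j)
  obtain ⟨y, hy⟩ := exists_sequence_of_prefixes (u := fun j => (P j).2)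
    (fun j => (List.prefix_append _ _).trans (hv' j)) hstep
  have hxu : ∀ j, initialSegment x (u₁ (P j)).length = u₁ (P j) := fun j =>
    initialSegment_eq_of_prefix ((hx (j + 1)).symm ▸ hu' j)
  have hyv : ∀ j, initialSegment y (v₁ (P j)).length = v₁ (P j) := fun j =>
    initialSegment_eq_of_prefix ((hy (j + 1)).symm ▸ hv' j)
  have hmono : StrictMono fun j => (P j).2.length := strictMono_nat_of_lt_succ hstep
  have hor : ∀ n ≥ (P 0).2.length, x n = k ∨ y n = k := by
    intro n hn
    obtain ⟨j, hj, hj'⟩ : ∃ j, (P j).2.length ≤ n ∧ n < (P (j + 1)).2.length := by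
      by_contra! h
      have : ∀ j, (P j).2.length ≤ n := fun j => Nat.rec hn h j
      exact (Nat.lt_succ_self n).not_ge ((hmono.le_apply (x := n + 1)).trans (this _))
    rcases lt_or_ge n (u₁ (P j)).length with h | h
    · exact .inr (eq_of_initialSegment_eq_append_replicate (hyv j) hj (by rwa [hlen]))
    · refine .inl (eq_of_initialSegment_eq_append_replicate (w := u₁ (P j))
        ((hx (j + 1)).trans (by rw [hP])) h ?_)
      rwa [(hinv _).2.2]
  -- The ultrafilter gives one of the two branches the limit `k`, yet both leave `T` infinitely
  -- often.
  have hev : ∀ᶠ n in (hyperfilter ℕ : Filter ℕ), x n = k ∨ y n = k :=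
    Nat.hyperfilter_le_atTop ((eventually_ge_atTop _).mono hor)
  rcases Ultrafilter.eventually_or.1 hev with h | h
  · obtain ⟨N, hN⟩ := eventually_atTop.1 (hT x h)
    refine (hu N).2 (hxu N ▸ hN _ ?_)
    exact ((hmono.le_apply (x := N)).trans (hinv N).2.2.ge).trans (hlu N).le
  · obtain ⟨N, hN⟩ := eventually_atTop.1 (hT y h)
    exact (hv N).2 (hy (N + 1) ▸ hN _ ((Nat.le_succ N).trans hmono.le_apply))

theorem exists_colouring : ∃ col : (ℕ → ℕ) → ℕ, ∀ T : ℕ → Set (List ℕ),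
    (∀ x, (Set.range (initialSegment x) \ T (col x)).Finite) → ∀ m : ℕ, ∃ s, ∀ k < m, s ∈ T k := by
  classical
  -- The default colour 0 is harmless: only branches that have a limit are used.
  refine ⟨fun x => if h : ∃ k, ∀ᶠ n in (hyperfilter ℕ : Filter ℕ), x n = k then h.choose else 0,
    fun T hT m => ?_⟩
  have hT' : ∀ k (x : ℕ → ℕ), (∀ᶠ n in (hyperfilter ℕ : Filter ℕ), x n = k) →
      ∀ᶠ n in atTop, initialSegment x n ∈ T k := by
    intro k x hx
    have h : ∃ k, ∀ᶠ n in (hyperfilter ℕ : Filter ℕ), x n = k := ⟨k, hx⟩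
    have hk : h.choose = k := by
      obtain ⟨n, h1, h2⟩ := (h.choose_spec.and hx).exists
      exact h1.symm.trans h2
    have := hT x
    simp only [dif_pos h, hk] at this
    rw [← Nat.cofinite_eq_atTop]
    refine (this.preimage (initialSegment_injective x).injOn).subset fun n hn => ⟨⟨n, rfl⟩, hn⟩
  have key : ∃ s, ∀ t, s <+: t → ∀ k < m, t ∈ T k := by
    induction m with
    | zero => exact ⟨[], by simp⟩
    | succ m ih =>
      obtain ⟨s, hs⟩ := ih
      obtain ⟨s', hss', hs'⟩ := exists_cylinder_subset (hT' m) s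
      refine ⟨s', fun t ht k hk => ?_⟩
      rcases Nat.lt_succ_iff_lt_or_eq.1 hk with h | rfl
      · exact hs t (hss'.trans ht) k h
      · exact hs' t ht
  exact key.imp fun s hs => hs s (List.prefix_refl s)

end Branches

theorem mainTheorem10 :
    ∃ (X : Type) (_ : TopologicalSpace X) (L : Set X),
      IsDyadicCompactum L ∧ topologicalWeight L = 𝔠 ∧
      IsCountableDiscreteExtension L ∧
      ¬ ∃ E : C(L, ℝ) →L[ℝ] C(X, ℝ), IsExtensionOperator E := by
  obtain ⟨col, hcol⟩ := exists_colouring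
  have hA : ∀ x y : ℕ → ℕ, col x ≠ col y →
      (Set.range (initialSegment x) ∩ Set.range (initialSegment y)).Finite := fun x y h =>
    finite_range_initialSegment_inter fun e => h (e ▸ rfl)
  refine ⟨extensionSet (fun x => Set.range (initialSegment x)) col, inferInstance,
    coreSet _ col, isDyadicCompactum_coreSet hA, ?_, isCountableDiscreteExtension_coreSet hA, ?_⟩
  · rw [topologicalWeight_coreSet]
    simp
  · rintro ⟨E, hE⟩
    obtain ⟨T, hT, m, hm⟩ := exists_almost_cover_of_extensionOperator hA hE
    obtain ⟨s, hs⟩ := hcol T hT m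
    obtain ⟨k, hk, hsk⟩ := hm s
    exact hsk (hs k hk)
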